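/- For $n\ge 0$ let $\Pi(n)$ be the set of set partitions of $[n]=\{1,\dots,n\}$, and let $B_n=|\Pi(n)|$ be the $n$-th Bell number, with the convention $B_m=0$ for $m<0$. An arc of $\lambda\in\Pi(n)$ is a pair $(e,f)$ of elements of a common block of $\lambda$ such that $f$ is the smallest element of that block greater than $e$. Let $i(\lambda)$ (the intertwining exponent of $\lambda$, equal to the number $cr_2(\lambda)$ of $2$-crossings) be the number of pairs of arcs $(e_1,f_1)$, $(e_2,f_2)$ of $\lambda$ with $e_1<e_2<f_1<f_2$, and put $M(i^k;n):=\sum_{\lambda\in\Pi(n)} i(\lambda)^k$ (with $0^0=1$). For each integer $k\ge 0$ there exist polynomials $Q_{k,2k},Q_{k,2k-1},\dots,Q_{k,-k}$ with rational coefficients, where $Q_{k,2k-j}$ has degree at most $j$ for $0\le j\le 3k$, such that for all integers $n\ge 0$ $$M(i^k;n)=\sum_{j=0}^{3k} Q_{k,2k-j}(n)\,B_{n+2k-j}.$$ Moreover, for all $n\ge 0$, $$M(i;n)=\tfrac14\bigl((2n+1)B_n+(2n+9)B_{n+1}-5B_{n+2}\bigr),$$ $$M(i^2;n)=\tfrac1{144}\bigl((36n^2+24n-23)B_n+(72n^2+72n-260)B_{n+1}+(36n^2+156n+489)B_{n+2}-(180n+814)B_{n+3}+225B_{n+4}\bigr).$$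 -/

import Mathlib

namespace SetPartition

/-- The arcs of a set partition `P` of `[n] = {1, …, n}`: the pairs `(i, j)` with `i < j` in a common
block such that no element of that block lies strictly between `i` and `j`. -/
def arcs {n : ℕ} (P : Finpartition (Finset.Icc 1 n)) : Finset (ℕ × ℕ) :=
  (Finset.Icc 1 n ×ˢ Finset.Icc 1 n).filter fun e =>
    ∃ b ∈ P.parts, e.1 ∈ b ∧ e.2 ∈ b ∧ e.1 < e.2 ∧ ∀ m ∈ b, ¬ (e.1 < m ∧ m < e.2)

/-- The intertwining exponent: the number of pairs of arcs `(e₁, f₁)`, `(e₂, f₂)` with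
`e₁ < e₂ < f₁ < f₂`, that is, the number of 2-crossings. -/
def intertwining {n : ℕ} (P : Finpartition (Finset.Icc 1 n)) : ℕ :=
  ((arcs P ×ˢ arcs P).filter fun p =>
    p.1.1 < p.2.1 ∧ p.2.1 < p.1.2 ∧ p.1.2 < p.2.2).card

/-- The aggregate `M(i^k; n)` of the `k`-th power of the intertwining exponent over all set
partitions of `[n]`. -/
def moment (k n : ℕ) : ℚ :=
  ∑ P : Finpartition (Finset.Icc 1 n), (intertwining P : ℚ) ^ k

/-- The Bell number `B_m` for an integer index `m`, with `B_m = 0` for `m < 0`. -/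
def bell (m : ℤ) : ℚ :=
  if 0 ≤ m then (Nat.bell m.toNat : ℚ) else 0

end SetPartition

namespace SetPartition

open Finset

/-! ### Building set partitions one element at a time -/

section Arcs

variable {n : ℕ}

/-! Build a set partition by adding `n + 1` as a singleton or after the largest element `e` of a
block. The crossings gained depend on all arcs over `e`, so one decides in advance which blocks stay
open, and counts an open point lying under an arc as a crossing already (`openCrossings`). Closing
one of `h` open blocks then adds a number `c` of crossings, and each `c < h` occurs exactly once.
With `w` marking open blocks, this gives the recurrence `openMoment_succ`, in which `w ^ h` is sent
to `(∑ c < h, c ^ j) * w ^ (h - 1)`. As `∑ c < h, c ^ j` is a combination of falling factorials of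
`h`, that operator is a combination of `w ^ i * ∂_w ^ (i + 1)` (`powSumOp_eq`).

Passing to exponential generating functions in `z` turns the recurrence into a differential
equation. For `k = 0` its solution is `B(z) * exp (w * (exp z - 1))`. Divided by this series, the
equation for general `k` becomes the transport equation `∂_z g = (1 + w) * ∂_w g + T` with `T`
determined by lower moments. On `z ^ b * exp (s * z) * (1 + w) ^ l` the operator `∂_z - (1 + w) *
∂_w` lowers `b` or multiplies by `s - l`, so it can be inverted within such combinations at the cost
of one power of `z`. By induction (`exists_momentSeries_eq`) `b ≤ k` and `s, l ≤ 2 * k` suffice.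

At `w = 0` there remain the series `z ^ b * exp (s * z) * B(z)`. From `B' = exp z * B` the factor
`exp (s * z)` becomes a combination of shifts of the Bell numbers by at most `s`, and `z ^ b`
becomes a falling factorial of degree `b` with a shift by `-b`. The explicit formulas come from the
same solution for `k = 1, 2`. -/

theorem mem_arcs {P : Finpartition (Icc 1 n)} {e : ℕ × ℕ} :
    e ∈ arcs P ↔
      ∃ b ∈ P.parts, e.1 ∈ b ∧ e.2 ∈ b ∧ e.1 < e.2 ∧ ∀ m ∈ b, ¬ (e.1 < m ∧ m < e.2) := by
  simp only [arcs, mem_filter, mem_product, and_iff_right_iff_imp]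
  rintro ⟨b, hb, h1, h2, -⟩
  exact ⟨P.subset hb h1, P.subset hb h2⟩

theorem arcs_snd_le {P : Finpartition (Icc 1 n)} {e : ℕ × ℕ} (he : e ∈ arcs P) : e.2 ≤ n := by
  simp only [arcs, mem_filter, mem_product, mem_Icc] at he
  exact he.1.2.2

theorem arcs_fst_lt_snd {P : Finpartition (Icc 1 n)} {e : ℕ × ℕ} (he : e ∈ arcs P) :
    e.1 < e.2 := by
  obtain ⟨b, -, -, -, h, -⟩ := mem_arcs.1 he
  exact h

/-- The points of `[n]` from which no arc of `A` starts. -/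
def nonStarts (n : ℕ) (A : Finset (ℕ × ℕ)) : Finset ℕ :=
  (Icc 1 n).filter fun e => ∀ a ∈ A, a.1 ≠ e

theorem mem_nonStarts_arcs {P : Finpartition (Icc 1 n)} {e : ℕ} :
    e ∈ nonStarts n (arcs P) ↔ ∃ b ∈ P.parts, e ∈ b ∧ ∀ m ∈ b, m ≤ e := by
  simp only [nonStarts, mem_filter]
  constructor
  · rintro ⟨he, h⟩
    refine ⟨P.part e, P.part_mem.2 he, P.mem_part_self.2 he, fun m hm => ?_⟩
    by_contra! hlt
    have hne : ((P.part e).filter (e < ·)).Nonempty := ⟨m, mem_filter.2 ⟨hm, hlt⟩⟩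
    have hmin := min'_mem _ hne
    rw [mem_filter] at hmin
    refine h (e, ((P.part e).filter (e < ·)).min' hne) (mem_arcs.2
      ⟨P.part e, P.part_mem.2 he, P.mem_part_self.2 he, hmin.1, hmin.2, fun x hx hx' => ?_⟩) rfl
    exact absurd (min'_le _ x (mem_filter.2 ⟨hx, hx'.1⟩)) (not_le.2 hx'.2)
  · rintro ⟨b, hb, he, hmax⟩
    refine ⟨P.subset hb he, fun a ha hae => ?_⟩
    obtain ⟨c, hc, h1, h2, h3, -⟩ := mem_arcs.1 ha
    rw [hae] at h1
    obtain rfl := P.eq_of_mem_parts hb hc he h1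
    have := hmax _ h2
    omega

/-- Add the element `n + 1` to the block `c` of a set partition of `[n]`, or as a singleton block
if `c = ∅`. -/
def adjoin (P : Finpartition (Icc 1 n)) (c : Finset ℕ) (hc : c ∈ insert ∅ P.parts) :
    Finpartition (Icc 1 (n + 1)) :=
  Finpartition.ofExistsUnique (insert (insert (n + 1) c) (P.parts.erase c))
    (by
      have hsub : c ⊆ Icc 1 n := by
        rcases mem_insert.1 hc with rfl | h
        · simp
        · exact P.subset h
      intro p hp
      rcases mem_insert.1 hp with rfl | h
      · refine insert_subset (by simp) (hsub.trans (Icc_subset_Icc_right (by omega)))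
      · exact (P.subset (mem_of_mem_erase h)).trans (Icc_subset_Icc_right (by omega)))
    (by
      have hn : ∀ p ∈ P.parts, n + 1 ∉ p := fun p hp h => by
        have := mem_Icc.1 (P.subset hp h)
        omega
      intro a ha
      by_cases han : a = n + 1
      · subst han
        refine ⟨insert (n + 1) c, ⟨mem_insert_self _ _, mem_insert_self _ _⟩, ?_⟩
        rintro p ⟨hp, hap⟩
        rcases mem_insert.1 hp with rfl | h
        · rfl
        · exact absurd hap (hn _ (mem_of_mem_erase h))
      · have ha' : a ∈ Icc 1 n := by
          rw [mem_Icc] at ha ⊢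
          omega
        by_cases hac : a ∈ c
        · refine ⟨insert (n + 1) c, ⟨mem_insert_self _ _, mem_insert_of_mem hac⟩, ?_⟩
          rintro p ⟨hp, hap⟩
          rcases mem_insert.1 hp with rfl | h
          · rfl
          · rw [mem_erase] at h
            rcases mem_insert.1 hc with rfl | hc
            · simp at hac
            · exact absurd (P.eq_of_mem_parts h.2 hc hap hac) h.1
        · refine ⟨P.part a, ⟨mem_insert_of_mem (mem_erase.2 ⟨?_, P.part_mem.2 ha'⟩),
            P.mem_part_self.2 ha'⟩, ?_⟩
          · rintro rfl
            exact hac (P.mem_part_self.2 ha')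
          · rintro p ⟨hp, hap⟩
            rcases mem_insert.1 hp with rfl | h
            · simp [han, hac] at hap
            · exact (P.part_eq_of_mem (mem_of_mem_erase h) hap).symm)
    (by
      intro h
      rcases mem_insert.1 h with h | h
      · exact (insert_ne_empty _ _) h.symm
      · exact P.empty_notMem_parts (mem_of_mem_erase h))

theorem adjoin_parts (P : Finpartition (Icc 1 n)) (c : Finset ℕ) (hc : c ∈ insert ∅ P.parts) :
    (adjoin P c hc).parts = insert (insert (n + 1) c) (P.parts.erase c) := rfl

/-- Remove the element `n + 1` from a set partition of `[n + 1]`. -/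
def dropLast (P : Finpartition (Icc 1 (n + 1))) : Finpartition (Icc 1 n) :=
  (P.avoid {n + 1}).copy (by
    ext a
    simp only [mem_sdiff, mem_Icc, mem_singleton]
    omega)

theorem mem_dropLast {P : Finpartition (Icc 1 (n + 1))} {c : Finset ℕ} :
    c ∈ (dropLast P).parts ↔ ∃ d ∈ P.parts, ¬ d ⊆ {n + 1} ∧ d.erase (n + 1) = c := by
  simp only [dropLast, Finpartition.copy_parts, Finpartition.mem_avoid,
    sdiff_singleton_eq_erase]

theorem notMem_of_mem_parts {P : Finpartition (Icc 1 n)} {c : Finset ℕ} (hc : c ∈ P.parts) :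
    n + 1 ∉ c := fun h => by
  have := mem_Icc.1 (P.subset hc h)
  omega

theorem notMem_of_mem_insert {P : Finpartition (Icc 1 n)} {c : Finset ℕ}
    (hc : c ∈ insert ∅ P.parts) : n + 1 ∉ c := by
  rcases mem_insert.1 hc with rfl | h
  · simp
  · exact notMem_of_mem_parts h

theorem dropLast_adjoin (P : Finpartition (Icc 1 n)) (c : Finset ℕ)
    (hc : c ∈ insert ∅ P.parts) : dropLast (adjoin P c hc) = P := by
  have hcn := notMem_of_mem_insert hc
  ext1
  ext d
  rw [mem_dropLast, adjoin_parts]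
  constructor
  · rintro ⟨b, hb, hbn, rfl⟩
    rcases mem_insert.1 hb with rfl | hb
    · rw [erase_insert hcn]
      rcases mem_insert.1 hc with rfl | h
      · simp at hbn
      · exact h
    · rw [mem_erase] at hb
      rw [erase_eq_of_notMem (notMem_of_mem_parts hb.2)]
      exact hb.2
  · intro hd
    obtain ⟨x, hx⟩ := P.nonempty_of_mem_parts hd
    have hxn : x ≠ n + 1 := fun h => notMem_of_mem_parts hd (h ▸ hx)
    by_cases hdc : d = c
    · subst hdc
      refine ⟨insert (n + 1) d, mem_insert_self _ _, fun h => hxn ?_, erase_insert hcn⟩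
      simpa using h (mem_insert_of_mem hx)
    · exact ⟨d, mem_insert_of_mem (mem_erase.2 ⟨hdc, hd⟩), fun h => hxn (by simpa using h hx),
        erase_eq_of_notMem (notMem_of_mem_parts hd)⟩

theorem part_adjoin (P : Finpartition (Icc 1 n)) (c : Finset ℕ)
    (hc : c ∈ insert ∅ P.parts) : (adjoin P c hc).part (n + 1) = insert (n + 1) c :=
  Finpartition.part_eq_of_mem _ (by rw [adjoin_parts]; exact mem_insert_self _ _)
    (mem_insert_self _ _)

theorem part_erase_mem (P : Finpartition (Icc 1 (n + 1))) :
    (P.part (n + 1)).erase (n + 1) ∈ insert ∅ (dropLast P).parts := by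
  rw [mem_insert, mem_dropLast]
  by_cases h : P.part (n + 1) ⊆ {n + 1}
  · left
    rw [erase_eq_empty_iff]
    exact subset_singleton_iff.1 h
  · exact Or.inr ⟨_, P.part_mem.2 (by simp), h, rfl⟩

theorem adjoin_dropLast (P : Finpartition (Icc 1 (n + 1))) :
    adjoin (dropLast P) ((P.part (n + 1)).erase (n + 1)) (part_erase_mem P) = P := by
  have hself : n + 1 ∈ P.part (n + 1) := P.mem_part_self.2 (by simp)
  have hpart : P.part (n + 1) ∈ P.parts := P.part_mem.2 (by simp)
  ext1
  ext d
  rw [adjoin_parts, insert_erase hself, mem_insert, mem_erase, mem_dropLast]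
  constructor
  · rintro (rfl | ⟨hne, b, hb, -, rfl⟩)
    · exact hpart
    · by_cases hbn : n + 1 ∈ b
      · rw [P.part_eq_of_mem hb hbn] at hne
        exact absurd rfl hne
      · rwa [erase_eq_of_notMem hbn]
  · intro hd
    by_cases hdn : n + 1 ∈ d
    · exact Or.inl (P.part_eq_of_mem hd hdn).symm
    · refine Or.inr ⟨?_, d, hd, fun h => ?_, erase_eq_of_notMem hdn⟩
      · rintro rfl
        obtain ⟨x, hx⟩ := P.nonempty_of_mem_parts hd
        have := P.eq_of_mem_parts hd hpart hx (mem_of_mem_erase hx)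
        exact hdn (by rw [this]; exact hself)
      · obtain ⟨x, hx⟩ := P.nonempty_of_mem_parts hd
        exact hdn (by simpa [mem_singleton.1 (h hx)] using hx)

theorem arcs_adjoin_empty (P : Finpartition (Icc 1 n)) :
    arcs (adjoin P ∅ (mem_insert_self _ _)) = arcs P := by
  ext e
  rw [mem_arcs, mem_arcs, adjoin_parts, erase_eq_of_notMem P.empty_notMem_parts, exists_mem_insert,
    or_iff_right]
  simp only [insert_empty_eq, mem_singleton]
  omega

theorem arcs_adjoin (P : Finpartition (Icc 1 n)) {c : Finset ℕ} {e : ℕ} (hc : c ∈ P.parts)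
    (hec : e ∈ c) (hmax : ∀ m ∈ c, m ≤ e) :
    arcs (adjoin P c (mem_insert_of_mem hc)) = insert (e, n + 1) (arcs P) := by
  have hle : ∀ m ∈ c, m ≤ n := fun m hm => (mem_Icc.1 (P.subset hc hm)).2
  ext a
  rw [mem_insert, mem_arcs, mem_arcs, adjoin_parts, exists_mem_insert]
  constructor
  · rintro (⟨h1, h2, h3, h4⟩ | ⟨b, hb, h⟩)
    · rcases mem_insert.1 h2 with h2 | h2
      · have h1c : a.1 ∈ c := (mem_insert.1 h1).resolve_left (by omega)
        have := hmax _ h1c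
        have h5 := h4 e (mem_insert_of_mem hec)
        have := hle e hec
        left
        ext <;> simp only <;> omega
      · have := hle _ h2
        have h1c : a.1 ∈ c := (mem_insert.1 h1).resolve_left (by omega)
        exact Or.inr ⟨c, hc, h1c, h2, h3, fun m hm => h4 m (mem_insert_of_mem hm)⟩
    · exact Or.inr ⟨b, mem_of_mem_erase hb, h⟩
  · rintro (rfl | ⟨b, hb, h1, h2, h3, h4⟩)
    · left
      refine ⟨mem_insert_of_mem hec, mem_insert_self _ _, Nat.lt_succ_of_le (hle e hec),
        fun m hm hlt => ?_⟩
      rcases mem_insert.1 hm with rfl | hm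
      · exact lt_irrefl _ hlt.2
      · exact absurd (hmax m hm) (not_le.2 hlt.1)
    · by_cases hbc : b = c
      · subst hbc
        left
        refine ⟨mem_insert_of_mem h1, mem_insert_of_mem h2, h3, fun m hm hlt => ?_⟩
        rcases mem_insert.1 hm with rfl | hm
        · have := hle _ h2
          omega
        · exact h4 m hm hlt
      · exact Or.inr ⟨b, mem_erase.2 ⟨hbc, hb⟩, h1, h2, h3, h4⟩

/-- A set partition of `[n + 1]` is a set partition of `[n]` with a choice of a block (or of the
empty set) to which `n + 1` is added. -/
def adjoinEquiv (n : ℕ) :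
    (Σ P : Finpartition (Icc 1 n), {c // c ∈ insert ∅ P.parts}) ≃ Finpartition (Icc 1 (n + 1)) where
  toFun x := adjoin x.1 x.2.1 x.2.2
  invFun P := ⟨dropLast P, (P.part (n + 1)).erase (n + 1), part_erase_mem P⟩
  left_inv := by
    rintro ⟨P, c, hc⟩
    -- Variables `Q` and `d` can be substituted, which avoids heterogeneous equality between the
    -- block components.
    have hext : ∀ (Q : Finpartition (Icc 1 n)) (d : Finset ℕ) (hd : d ∈ insert ∅ Q.parts),
        Q = P → d = c → (⟨Q, d, hd⟩ : Σ P : Finpartition (Icc 1 n),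
          {c // c ∈ insert ∅ P.parts}) = ⟨P, c, hc⟩ := by
      rintro Q d hd rfl rfl
      rfl
    refine hext _ _ _ (dropLast_adjoin P c hc) ?_
    rw [part_adjoin, erase_insert (notMem_of_mem_insert hc)]
  right_inv P := adjoin_dropLast P

/-- A sum over the set partitions of `[n + 1]`, in terms of the set partitions of `[n]`: the element
`n + 1` is either a singleton block, or it is joined to the largest element of a block. -/
theorem sum_arcs_succ {M : Type*} [AddCommMonoid M] (F : Finset (ℕ × ℕ) → M) (n : ℕ) :
    ∑ P : Finpartition (Icc 1 (n + 1)), F (arcs P) =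
      ∑ P : Finpartition (Icc 1 n),
        (F (arcs P) + ∑ e ∈ nonStarts n (arcs P), F (insert (e, n + 1) (arcs P))) := by
  have hfib : ∀ P : Finpartition (Icc 1 n),
      ∑ c : {c // c ∈ insert ∅ P.parts}, F (arcs (adjoin P c.1 c.2)) =
        F (arcs P) + ∑ e ∈ nonStarts n (arcs P), F (insert (e, n + 1) (arcs P)) := by
    intro P
    -- Extending by the dummy value `0` removes the dependence on the membership proof, so the sum
    -- over the subtype becomes one over a finset.
    let G : Finset ℕ → M := fun c =>
      if hc : c ∈ insert ∅ P.parts then F (arcs (adjoin P c hc)) else 0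
    have hG : ∀ c (hc : c ∈ insert ∅ P.parts), F (arcs (adjoin P c hc)) = G c :=
      fun c hc => by simp only [G, dif_pos hc]
    rw [Fintype.sum_congr _ (fun c => G c.1) (fun c => hG c.1 c.2),
      Finset.sum_coe_sort (insert ∅ P.parts) G, sum_insert P.empty_notMem_parts,
      ← hG ∅ (mem_insert_self _ _), arcs_adjoin_empty]
    congr 1
    symm
    -- Points without an outgoing arc are exactly the block maxima, hence correspond to blocks.
    refine sum_bij (fun e _ => P.part e) ?_ ?_ ?_ ?_
    · intro e he
      obtain ⟨b, hb, heb, -⟩ := mem_nonStarts_arcs.1 he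
      exact P.part_mem.2 (P.subset hb heb)
    · intro e he e' he' hee
      obtain ⟨b, hb, heb, hmax⟩ := mem_nonStarts_arcs.1 he
      obtain ⟨b', hb', heb', hmax'⟩ := mem_nonStarts_arcs.1 he'
      rw [P.part_eq_of_mem hb heb, P.part_eq_of_mem hb' heb'] at hee
      subst hee
      exact le_antisymm (hmax' _ heb) (hmax _ heb')
    · intro b hb
      have hne := P.nonempty_of_mem_parts hb
      refine ⟨b.max' hne, mem_nonStarts_arcs.2 ⟨b, hb, max'_mem _ _, fun m hm => le_max' _ _ hm⟩,
        P.part_eq_of_mem hb (max'_mem _ _)⟩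
    · intro e he
      obtain ⟨b, hb, heb, hmax⟩ := mem_nonStarts_arcs.1 he
      rw [P.part_eq_of_mem hb heb, ← hG b (mem_insert_of_mem hb), arcs_adjoin P hb heb hmax]
  rw [← Fintype.sum_congr _ _ hfib, ← Fintype.sum_sigma',
    ← Equiv.sum_comp (adjoinEquiv n) (fun P => F (arcs P))]
  rfl

end Arcs

end SetPartition

namespace SetPartition

open Finset PowerSeries

/-! ### Partitions with open blocks and the recurrence for their moments -/

section States

/-- The operator on power series that sends `X ^ h` to `(∑ c < h, c ^ j) * X ^ (h - 1)`. -/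
noncomputable def powSumOp (R : Type*) [CommRing R] (j : ℕ) : R⟦X⟧ →ₗ[R] R⟦X⟧ where
  toFun f := PowerSeries.mk fun h => (∑ c ∈ range (h + 1), (c : R) ^ j) * coeff (h + 1) f
  map_add' f g := by
    ext h
    simp [mul_add]
  map_smul' r f := by
    ext h
    simp [mul_left_comm]

theorem coeff_powSumOp {R : Type*} [CommRing R] (j h : ℕ) (f : R⟦X⟧) :
    coeff h (powSumOp R j f) = (∑ c ∈ range (h + 1), (c : R) ^ j) * coeff (h + 1) f := by
  simp [powSumOp]

theorem powSumOp_X_pow {R : Type*} [CommRing R] (j h : ℕ) :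
    powSumOp R j (X ^ h) = (∑ c ∈ range h, (c : R) ^ j) • (X : R⟦X⟧) ^ (h - 1) := by
  ext i
  rw [coeff_powSumOp, coeff_smul, coeff_X_pow, coeff_X_pow, smul_eq_mul]
  rcases h with _ | h
  · simp
  · by_cases hi : i = h
    · simp [hi]
    · simp [hi]

/-- The number of crossings of the arcs in `A` together with infinite arcs starting from the points
in `O`, where infinite arcs do not cross each other. -/
def openCrossings (A : Finset (ℕ × ℕ)) (O : Finset ℕ) : ℕ :=
  ((A ×ˢ A).filter fun p => p.1.1 < p.2.1 ∧ p.2.1 < p.1.2 ∧ p.1.2 < p.2.2).card +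
    ((A ×ˢ O).filter fun p => p.1.1 < p.2 ∧ p.2 < p.1.2).card

variable {n : ℕ} {A : Finset (ℕ × ℕ)} {O : Finset ℕ} {e : ℕ}

theorem openCrossings_empty_right {P : Finpartition (Icc 1 n)} :
    openCrossings (arcs P) ∅ = intertwining P := by
  simp [openCrossings, intertwining]

theorem nonStarts_succ (hA : ∀ a ∈ A, a.1 ≤ n) :
    nonStarts (n + 1) A = insert (n + 1) (nonStarts n A) := by
  ext x
  simp only [nonStarts, mem_filter, mem_insert, mem_Icc]
  constructor
  · rintro ⟨h1, h2⟩
    by_cases hx : x = n + 1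
    · exact Or.inl hx
    · exact Or.inr ⟨by omega, h2⟩
  · rintro (rfl | ⟨h1, h2⟩)
    · refine ⟨by omega, fun a ha h => ?_⟩
      have := hA a ha
      omega
    · exact ⟨by omega, h2⟩

theorem nonStarts_insert (f : ℕ) : nonStarts n (insert (e, f) A) = (nonStarts n A).erase e := by
  ext x
  simp only [nonStarts, mem_filter, mem_insert, mem_erase, forall_eq_or_imp]
  constructor
  · rintro ⟨h1, h2, h3⟩
    exact ⟨fun h => h2 h.symm, h1, h3⟩
  · rintro ⟨h2, h1, h3⟩
    exact ⟨h1, fun h => h2 h.symm, h3⟩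

theorem notMem_nonStarts : n + 1 ∉ nonStarts n A := by
  simp [nonStarts]

/-- No arc passes over `n + 1`, so opening a block there costs nothing. -/
theorem openCrossings_insert_right (hA : ∀ a ∈ A, a.2 ≤ n + 1) :
    openCrossings A (insert (n + 1) O) = openCrossings A O := by
  unfold openCrossings
  congr 2
  ext ⟨a, o⟩
  simp only [mem_filter, mem_product, mem_insert]
  constructor
  · rintro ⟨⟨ha, rfl | ho⟩, h⟩
    · have := hA a ha
      omega
    · exact ⟨⟨ha, ho⟩, h⟩
  · rintro ⟨⟨ha, ho⟩, h⟩
    exact ⟨⟨ha, Or.inr ho⟩, h⟩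

/-- The arcs over `e` are crossed by the new arc, but they were already counted while `e` was open.
The only new crossings are with open points under the new arc, those beyond `e`. -/
theorem openCrossings_insert_left (hA : ∀ a ∈ A, a.2 ≤ n) (he : e ∉ O)
    (hO : ∀ o ∈ O, o ≤ n) :
    openCrossings (insert (e, n + 1) A) O =
      openCrossings A (insert e O) + (O.filter (e < ·)).card := by
  have heA : (e, n + 1) ∉ A := fun h => by
    have := hA _ h
    simp at this
  have h1 : ((insert (e, n + 1) A ×ˢ insert (e, n + 1) A).filter
        fun p => p.1.1 < p.2.1 ∧ p.2.1 < p.1.2 ∧ p.1.2 < p.2.2).card =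
      ((A ×ˢ A).filter fun p => p.1.1 < p.2.1 ∧ p.2.1 < p.1.2 ∧ p.1.2 < p.2.2).card +
        (A.filter fun a => a.1 < e ∧ e < a.2).card := by
    simp only [card_filter, sum_product, sum_insert heA]
    have h0 : ∀ a ∈ A, ¬ (n + 1 < a.2) := fun a ha => by
      have := hA a ha
      omega
    have h0' : ∀ a ∈ A, a.2 < n + 1 := fun a ha => by
      have := hA a ha
      omega
    rw [sum_eq_zero (fun a ha => if_neg fun h => h0 a ha h.2.2), if_neg (by omega), sum_add_distrib,
      sum_congr rfl (fun a ha => if_congr (show (a.1 < e ∧ e < a.2 ∧ a.2 < n + 1) ↔ (a.1 < e ∧ e < a.2)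
        by simp [h0' a ha]) rfl rfl)]
    ring
  have h2 : ((insert (e, n + 1) A ×ˢ O).filter fun p => p.1.1 < p.2 ∧ p.2 < p.1.2).card =
      (O.filter (e < ·)).card + ((A ×ˢ O).filter fun p => p.1.1 < p.2 ∧ p.2 < p.1.2).card := by
    simp only [card_filter, sum_product, sum_insert heA]
    congr 1
    refine sum_congr rfl fun o ho => if_congr ?_ rfl rfl
    have := hO o ho
    omega
  have h3 : ((A ×ˢ insert e O).filter fun p => p.1.1 < p.2 ∧ p.2 < p.1.2).card =
      (A.filter fun a => a.1 < e ∧ e < a.2).card +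
        ((A ×ˢ O).filter fun p => p.1.1 < p.2 ∧ p.2 < p.1.2).card := by
    simp only [card_filter, sum_product, sum_insert he, sum_add_distrib]
  unfold openCrossings
  rw [h1, h2, h3]
  ring

/-- The number of elements above `e` is the rank of `e` from the top, which takes each value below
`T.card` once. -/
theorem sum_card_filter_gt {M : Type*} [AddCommMonoid M] (T : Finset ℕ) (g : ℕ → M) :
    ∑ e ∈ T, g (T.filter (e < ·)).card = ∑ c ∈ range T.card, g c := by
  induction T using Finset.induction_on_max generalizing g with
  | empty => simp
  | insert a s hs ih =>
    have ha : a ∉ s := fun h => lt_irrefl _ (hs a h)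
    rw [sum_insert ha, card_insert_of_notMem ha, sum_range_succ', add_comm]
    congr 1
    · rw [← ih]
      refine sum_congr rfl fun e he => ?_
      rw [filter_insert, if_pos (hs e he), card_insert_of_notMem (by simp [ha])]
    · congr 1
      rw [card_eq_zero, filter_eq_empty_iff]
      intro x hx
      rcases mem_insert.1 hx with rfl | hx
      · exact lt_irrefl _
      · exact not_lt.2 (hs x hx).le

theorem sum_powerset_erase {M : Type*} [AddCommMonoid M] (F : Finset ℕ)
    (φ : ℕ → Finset ℕ → M) :
    ∑ e ∈ F, ∑ O ∈ (F.erase e).powerset, φ e (insert e O) =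
      ∑ T ∈ F.powerset, ∑ e ∈ T, φ e T := by
  rw [sum_sigma', sum_sigma']
  refine sum_bij' (fun x _ => ⟨insert x.1 x.2, x.1⟩) (fun x _ => ⟨x.2, x.1.erase x.2⟩)
    ?_ ?_ ?_ ?_ ?_
  · rintro ⟨e, O⟩ h
    simp only [mem_sigma, mem_powerset] at h ⊢
    exact ⟨insert_subset h.1 (h.2.trans (erase_subset _ _)), mem_insert_self _ _⟩
  · rintro ⟨T, e⟩ h
    simp only [mem_sigma, mem_powerset] at h ⊢
    exact ⟨h.1 h.2, erase_subset_erase _ h.1⟩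
  · rintro ⟨e, O⟩ h
    simp only [mem_sigma, mem_powerset] at h
    have : e ∉ O := fun he => notMem_erase e F (h.2 he)
    simp [erase_insert this]
  · rintro ⟨T, e⟩ h
    simp only [mem_sigma, mem_powerset] at h
    simp [insert_erase h.2]
  · rintro ⟨e, O⟩ h
    rfl

/-- The generating polynomial of the `k`-th powers of the numbers of crossings of the set partitions
of `[n]` with some open blocks, in which `X` marks the number of open blocks. -/
noncomputable def openMoment (n k : ℕ) : ℚ⟦X⟧ :=
  ∑ P : Finpartition (Icc 1 n), ∑ O ∈ (nonStarts n (arcs P)).powerset,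
    (openCrossings (arcs P) O : ℚ) ^ k • X ^ O.card

theorem sum_powerset_insert_last (hA : ∀ a ∈ A, a.2 ≤ n + 1) {F : Finset ℕ} (hF : n + 1 ∉ F)
    (k : ℕ) :
    ∑ O ∈ (insert (n + 1) F).powerset, (openCrossings A O : ℚ) ^ k • (X : ℚ⟦X⟧) ^ O.card =
      (1 + X) * ∑ O ∈ F.powerset, (openCrossings A O : ℚ) ^ k • X ^ O.card := by
  rw [sum_powerset_insert hF, add_mul, one_mul, mul_sum]
  congr 1
  refine sum_congr rfl fun O hO => ?_
  rw [openCrossings_insert_right hA,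
    card_insert_of_notMem fun h => hF (mem_powerset.1 hO h), mul_smul_comm, pow_succ']

/-- The factor `1 + X` records whether `n + 1` is left closed or open; in the bracket, it either
starts a block or closes one of the open ones. The binomial theorem for `(crossings + c) ^ k` gives
the sum over `j`. -/
theorem openMoment_succ (n k : ℕ) :
    openMoment (n + 1) k = (1 + X) * (openMoment n k +
      ∑ j ∈ range (k + 1), (k.choose j : ℚ) • powSumOp ℚ j (openMoment n (k - j))) := by
  have hmain : ∀ P : Finpartition (Icc 1 n),
      ∑ e ∈ nonStarts n (arcs P), ∑ O ∈ ((nonStarts n (arcs P)).erase e).powerset,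
        (openCrossings (insert (e, n + 1) (arcs P)) O : ℚ) ^ k • (X : ℚ⟦X⟧) ^ O.card =
      ∑ T ∈ (nonStarts n (arcs P)).powerset, ∑ j ∈ range (k + 1), (k.choose j : ℚ) •
        powSumOp ℚ j ((openCrossings (arcs P) T : ℚ) ^ (k - j) • X ^ T.card) := by
    intro P
    -- Here `T` is the open set before the step, with `e` the point to be closed.
    have h := sum_powerset_erase (nonStarts n (arcs P)) fun e T =>
      ((openCrossings (arcs P) T + (T.filter (e < ·)).card : ℕ) : ℚ) ^ k •
        (X : ℚ⟦X⟧) ^ (T.card - 1)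
    rw [sum_congr rfl fun e he => sum_congr rfl fun O hO => ?_, h]
    · refine sum_congr rfl fun T _ => ?_
      rw [sum_card_filter_gt T fun c => ((openCrossings (arcs P) T + c : ℕ) : ℚ) ^ k •
        (X : ℚ⟦X⟧) ^ (T.card - 1), ← sum_smul]
      simp only [map_smul, powSumOp_X_pow, smul_smul, ← sum_smul]
      congr 1
      push_cast
      simp only [mul_sum]
      rw [sum_comm]
      refine sum_congr rfl fun c _ => ?_
      rw [add_comm, add_pow]
      refine sum_congr rfl fun j _ => ?_
      ring
    · have hO' := mem_powerset.1 hO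
      have heO : e ∉ O := fun h => notMem_erase _ _ (hO' h)
      rw [openCrossings_insert_left (fun a ha => arcs_snd_le ha) heO (fun o ho => ?_),
        card_insert_of_notMem heO, Nat.add_sub_cancel, filter_insert, if_neg (lt_irrefl _)]
      have := mem_of_mem_erase (hO' ho)
      simp only [nonStarts, mem_filter, mem_Icc] at this
      exact this.1.2
  have hP : ∀ P : Finpartition (Icc 1 n), ∀ a ∈ arcs P, a.1 ≤ n := fun P a ha =>
    (arcs_fst_lt_snd ha).le.trans (arcs_snd_le ha)
  rw [openMoment, sum_arcs_succ (fun A => ∑ O ∈ (nonStarts (n + 1) A).powerset,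
    (openCrossings A O : ℚ) ^ k • (X : ℚ⟦X⟧) ^ O.card)]
  have hstep : ∀ P : Finpartition (Icc 1 n), ∀ e ∈ nonStarts n (arcs P),
      ∑ O ∈ (nonStarts (n + 1) (insert (e, n + 1) (arcs P))).powerset,
        (openCrossings (insert (e, n + 1) (arcs P)) O : ℚ) ^ k • (X : ℚ⟦X⟧) ^ O.card =
      (1 + X) * ∑ O ∈ ((nonStarts n (arcs P)).erase e).powerset,
        (openCrossings (insert (e, n + 1) (arcs P)) O : ℚ) ^ k • (X : ℚ⟦X⟧) ^ O.card := by
    intro P e he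
    have hen : e ≠ n + 1 := fun h => notMem_nonStarts (h ▸ he)
    rw [nonStarts_insert, nonStarts_succ (hP P), erase_insert_of_ne hen.symm]
    refine sum_powerset_insert_last (fun a ha => ?_)
      (fun h => notMem_nonStarts (mem_of_mem_erase h)) k
    rcases mem_insert.1 ha with rfl | ha
    · exact le_rfl
    · exact (arcs_snd_le ha).trans (Nat.le_succ n)
  rw [sum_congr rfl fun P _ => show _ = (1 + X) *
    (∑ O ∈ (nonStarts n (arcs P)).powerset,
      (openCrossings (arcs P) O : ℚ) ^ k • (X : ℚ⟦X⟧) ^ O.card +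
    ∑ T ∈ (nonStarts n (arcs P)).powerset, ∑ j ∈ range (k + 1), (k.choose j : ℚ) •
        powSumOp ℚ j ((openCrossings (arcs P) T : ℚ) ^ (k - j) • X ^ T.card)) by
      rw [mul_add, ← hmain, sum_congr rfl (hstep P), ← mul_sum, nonStarts_succ (hP P),
        sum_powerset_insert_last (fun a ha => (arcs_snd_le ha).trans (Nat.le_succ n))
          notMem_nonStarts], ← mul_sum, sum_add_distrib]
  congr 2
  simp only [openMoment, map_sum, smul_sum]
  symm
  rw [sum_comm]
  refine sum_congr rfl fun P _ => ?_
  rw [sum_comm]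

theorem openMoment_zero (k : ℕ) : openMoment 0 k = if k = 0 then 1 else 0 := by
  have hN : ∀ A, nonStarts 0 A = ∅ := fun A => by simp [nonStarts]
  have hA : ∀ P : Finpartition (Icc 1 0), arcs P = ∅ := fun P => by simp [arcs]
  have hc : openCrossings ∅ ∅ = 0 := by simp [openCrossings]
  have : Unique (Finpartition (Icc 1 0)) :=
    inferInstanceAs (Unique (Finpartition (⊥ : Finset ℕ)))
  simp [openMoment, hN, hA, hc, zero_pow_eq]

theorem constantCoeff_openMoment (n k : ℕ) : constantCoeff (openMoment n k) = moment k n := by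
  simp only [openMoment, moment, map_sum]
  refine sum_congr rfl fun P _ => ?_
  rw [sum_eq_single_of_mem ∅ (empty_mem_powerset _), openCrossings_empty_right]
  · simp
  · intro O _ hO
    have : O.card ≠ 0 := card_ne_zero.2 (nonempty_iff_ne_empty.2 hO)
    simp [this]

end States

end SetPartition

namespace SetPartition

open Finset PowerSeries

/-! ### Power sums as differential operators -/

section PowerSums

theorem cast_descFactorial_succ (m i : ℕ) :
    ((m.descFactorial (i + 1) : ℕ) : ℚ) = (m - i) * (m.descFactorial i : ℕ) := by
  rcases le_or_gt i m with h | h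
  · rw [Nat.descFactorial_succ, Nat.cast_mul, Nat.cast_sub h]
  · rw [Nat.descFactorial_of_lt h, Nat.descFactorial_of_lt (by omega)]
    simp

theorem exists_pow_eq_sum_descFactorial (j : ℕ) :
    ∃ a : ℕ → ℚ, (∀ i, j < i → a i = 0) ∧
      ∀ c : ℕ, (c : ℚ) ^ j = ∑ i ∈ range (j + 1), a i * (c.descFactorial i : ℕ) := by
  induction j with
  | zero => exact ⟨fun i => if i = 0 then 1 else 0, fun i hi => by simp; omega, by simp⟩
  | succ j ih =>
    obtain ⟨a, ha, h⟩ := ih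
    -- Multiplying the falling factorial of order `i` by `c` gives the one of order `i + 1` plus `i`
    -- times itself.
    refine ⟨fun i => i * a i + if i = 0 then 0 else a (i - 1), fun i hi => ?_, fun c => ?_⟩
    · simp only
      rw [ha i (by omega), if_neg (by omega), ha (i - 1) (by omega)]
      simp
    · simp only [add_mul]
      rw [sum_add_distrib, sum_range_succ, ha (j + 1) (by omega),
        sum_range_succ' (fun i => (if i = 0 then (0 : ℚ) else a (i - 1)) * _), pow_succ, h, sum_mul]
      simp only [if_true, zero_mul, add_zero, mul_zero, ← sum_add_distrib,
        Nat.add_sub_cancel, Nat.succ_ne_zero, if_false]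
      refine sum_congr rfl fun i _ => ?_
      rw [cast_descFactorial_succ]
      ring

theorem sum_range_descFactorial (m i : ℕ) :
    ∑ c ∈ range m, ((c.descFactorial i : ℕ) : ℚ) = (m.descFactorial (i + 1) : ℕ) / (i + 1) := by
  induction m with
  | zero => simp
  | succ m ih =>
    rw [sum_range_succ, ih, Nat.succ_descFactorial_succ, cast_descFactorial_succ]
    push_cast
    field_simp
    ring

theorem exists_sum_pow_eq_sum_descFactorial (j : ℕ) :
    ∃ b : ℕ → ℚ, ∀ m : ℕ, ∑ c ∈ range m, (c : ℚ) ^ j =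
      ∑ i ∈ range (j + 1), b i * (m.descFactorial (i + 1) : ℕ) := by
  obtain ⟨a, -, h⟩ := exists_pow_eq_sum_descFactorial j
  refine ⟨fun i => a i / (i + 1), fun m => ?_⟩
  simp only [h]
  rw [sum_comm]
  refine sum_congr rfl fun i _ => ?_
  rw [← mul_sum, sum_range_descFactorial]
  ring

variable {R : Type*} [CommRing R]

theorem coeff_X_pow_mul_iterate_derivative (f : R⟦X⟧) (i h : ℕ) :
    coeff h (X ^ i * (d⁄dX R)^[i + 1] f) =
      ((h + 1).descFactorial (i + 1) : ℕ) * coeff (h + 1) f := by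
  rw [coeff_X_pow_mul']
  split_ifs with hi
  · obtain ⟨d, rfl⟩ := Nat.exists_eq_add_of_le hi
    rw [coeff_iterate_derivative, Nat.add_sub_cancel_left,
      show i + d + 1 = d + (i + 1) by ring, Nat.add_descFactorial_eq_ascFactorial]
  · rw [Nat.descFactorial_of_lt (by omega)]
    simp

theorem powSumOp_eq [Algebra ℚ R] {j : ℕ} {b : ℕ → ℚ}
    (hb : ∀ m : ℕ, ∑ c ∈ range m, (c : ℚ) ^ j =
      ∑ i ∈ range (j + 1), b i * (m.descFactorial (i + 1) : ℕ)) (f : R⟦X⟧) :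
    powSumOp R j f = ∑ i ∈ range (j + 1), b i • (X ^ i * (d⁄dX R)^[i + 1] f) := by
  ext h
  have := congrArg (algebraMap ℚ R) (hb (h + 1))
  simp only [map_sum, map_pow, map_mul, map_natCast] at this
  rw [coeff_powSumOp, this, map_sum, sum_mul]
  refine sum_congr rfl fun i _ => ?_
  rw [show coeff h (b i • (X ^ i * (d⁄dX R)^[i + 1] f)) =
    b i • coeff h (X ^ i * (d⁄dX R)^[i + 1] f) from rfl, coeff_X_pow_mul_iterate_derivative,
    Algebra.smul_def, mul_assoc]

theorem derivative_mul (f g : R⟦X⟧) : d⁄dX R (f * g) = f * d⁄dX R g + g * d⁄dX R f :=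
  (d⁄dX R).leibniz f g

theorem derivative_add (f g : R⟦X⟧) : d⁄dX R (f + g) = d⁄dX R f + d⁄dX R g :=
  map_add (d⁄dX R) f g

theorem derivative_zero : d⁄dX R (0 : R⟦X⟧) = 0 := map_zero (d⁄dX R)

theorem derivative_ratSmul [Algebra ℚ R] (r : ℚ) (f : R⟦X⟧) :
    d⁄dX R (r • f) = r • d⁄dX R f :=
  map_rat_smul (d⁄dX R) r f

theorem derivative_sub (f g : R⟦X⟧) : d⁄dX R (f - g) = d⁄dX R f - d⁄dX R g :=
  map_sub (d⁄dX R) f g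

theorem powSumOp_zero (f : R⟦X⟧) : powSumOp R 0 f = d⁄dX R f := by
  ext h
  rw [coeff_powSumOp, coeff_derivative]
  simp [mul_comm]

end PowerSums

/-! ### Exponential generating functions and division by the zeroth moment -/

section GeneratingFunction

/-- Differentiation of the coefficients of a power series with power series coefficients. -/
noncomputable def coeffDerivative : Derivation ℚ ℚ⟦X⟧⟦X⟧ ℚ⟦X⟧⟦X⟧ :=
  Derivation.mk'
    { toFun := fun f => PowerSeries.mk fun h => d⁄dX ℚ (coeff h f)
      map_add' := fun f g => by
        ext1 h
        simp
      map_smul' := fun r f => by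
        ext1 h
        rw [coeff_mk, show coeff h (r • f) = r • coeff h f from rfl, Derivation.map_smul,
          RingHom.id_apply, show ∀ g : ℚ⟦X⟧⟦X⟧, coeff h (r • g) = r • coeff h g from fun _ => rfl,
          coeff_mk] }
    (fun f g => by
      ext1 h
      simp only [LinearMap.coe_mk, AddHom.coe_mk, coeff_mk, coeff_mul, map_sum, Derivation.leibniz,
        smul_eq_mul, map_add, sum_add_distrib]
      congr 1
      exact (Nat.sum_antidiagonal_swap (n := h)
        (f := fun p => coeff p.1 g * d⁄dX ℚ (coeff p.2 f))))

theorem coeff_coeffDerivative (f : ℚ⟦X⟧⟦X⟧) (h : ℕ) :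
    coeff h (coeffDerivative f) = d⁄dX ℚ (coeff h f) := by
  simp [coeffDerivative]

theorem coeffDerivative_C (r : ℚ⟦X⟧) : coeffDerivative (C r) = C (d⁄dX ℚ r) := by
  ext1 h
  rw [coeff_coeffDerivative, coeff_C, coeff_C]
  split_ifs <;> simp

theorem coeffDerivative_X : coeffDerivative (X : ℚ⟦X⟧⟦X⟧) = 0 := by
  ext1 h
  rw [coeff_coeffDerivative, coeff_X]
  split_ifs <;> simp

/-- For a power series `f` in `w` whose coefficients are exponential generating functions in `z`,
the power series in `w` of the `n`-th terms of the sequences. -/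
noncomputable def egfTerm (n : ℕ) : ℚ⟦X⟧⟦X⟧ →ₗ[ℚ] ℚ⟦X⟧ where
  toFun f := PowerSeries.mk fun h => (n.factorial : ℚ) * coeff n (coeff h f)
  map_add' f g := by
    ext h
    simp [mul_add]
  map_smul' r f := by
    ext h
    rw [coeff_mk, show coeff h (r • f) = r • coeff h f from rfl]
    simp [mul_left_comm]

theorem coeff_egfTerm (n h : ℕ) (f : ℚ⟦X⟧⟦X⟧) :
    coeff h (egfTerm n f) = (n.factorial : ℚ) * coeff n (coeff h f) := by
  simp [egfTerm]

theorem egfTerm_coeffDerivative (n : ℕ) (f : ℚ⟦X⟧⟦X⟧) :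
    egfTerm n (coeffDerivative f) = egfTerm (n + 1) f := by
  ext h
  rw [coeff_egfTerm, coeff_egfTerm, coeff_coeffDerivative, coeff_derivative, Nat.factorial_succ]
  push_cast
  ring

theorem egfTerm_X_mul (n : ℕ) (f : ℚ⟦X⟧⟦X⟧) : egfTerm n (X * f) = X * egfTerm n f := by
  ext h
  rw [coeff_egfTerm]
  cases h with
  | zero => simp
  | succ h => rw [coeff_succ_X_mul, coeff_succ_X_mul, coeff_egfTerm]

theorem egfTerm_one_add_X_mul (n : ℕ) (f : ℚ⟦X⟧⟦X⟧) :
    egfTerm n ((1 + X) * f) = (1 + X) * egfTerm n f := by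
  rw [add_mul, add_mul, one_mul, one_mul, map_add, egfTerm_X_mul]

theorem egfTerm_powSumOp (n j : ℕ) (f : ℚ⟦X⟧⟦X⟧) :
    egfTerm n (powSumOp ℚ⟦X⟧ j f) = powSumOp ℚ j (egfTerm n f) := by
  ext h
  have : ∑ c ∈ range (h + 1), (c : ℚ⟦X⟧) ^ j = C (∑ c ∈ range (h + 1), (c : ℚ) ^ j) := by
    simp
  rw [coeff_egfTerm, coeff_powSumOp, coeff_powSumOp, this, coeff_C_mul, coeff_egfTerm]
  ring

theorem egfTerm_zero (f : ℚ⟦X⟧⟦X⟧) : egfTerm 0 f = PowerSeries.map constantCoeff f := by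
  ext h
  rw [coeff_egfTerm]
  simp

theorem egfTerm_zero_mul (f g : ℚ⟦X⟧⟦X⟧) : egfTerm 0 (f * g) = egfTerm 0 f * egfTerm 0 g := by
  simp only [egfTerm_zero, map_mul]

theorem eq_of_egfTerm {f g : ℚ⟦X⟧⟦X⟧} (hfg : ∀ n, egfTerm n f = egfTerm n g) : f = g := by
  ext h n
  have := congrArg (coeff h) (hfg n)
  rw [coeff_egfTerm, coeff_egfTerm] at this
  exact mul_left_cancel₀ (Nat.cast_ne_zero.2 n.factorial_ne_zero) this

/-- Uniqueness for the differential equation: it expresses the term of index `n + 1` linearly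
through that of index `n`. -/
theorem eq_zero_of_coeffDerivative_eq {f : ℚ⟦X⟧⟦X⟧}
    (hf : coeffDerivative f = (1 + X) * (f + d⁄dX ℚ⟦X⟧ f)) (h0 : egfTerm 0 f = 0) : f = 0 := by
  refine eq_of_egfTerm fun n => ?_
  rw [map_zero]
  induction n with
  | zero => exact h0
  | succ n ih =>
    rw [← egfTerm_coeffDerivative, hf, egfTerm_one_add_X_mul, map_add, ← powSumOp_zero,
      egfTerm_powSumOp, ih]
    simp

/-- The generating function of the moments of the crossing numbers of set partitions with open
blocks, exponential in the size. -/
noncomputable def momentSeries (k : ℕ) : ℚ⟦X⟧⟦X⟧ :=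
  PowerSeries.mk fun h => PowerSeries.mk fun n => coeff h (openMoment n k) / n.factorial

theorem egfTerm_momentSeries (n k : ℕ) : egfTerm n (momentSeries k) = openMoment n k := by
  ext h
  rw [coeff_egfTerm, momentSeries, coeff_mk, coeff_mk,
    mul_div_cancel₀ _ (Nat.cast_ne_zero.2 n.factorial_ne_zero)]

theorem coeffDerivative_momentSeries (k : ℕ) :
    coeffDerivative (momentSeries k) = (1 + X) * (momentSeries k +
      ∑ j ∈ range (k + 1), (k.choose j : ℚ) • powSumOp ℚ⟦X⟧ j (momentSeries (k - j))) := by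
  refine eq_of_egfTerm fun n => ?_
  rw [egfTerm_coeffDerivative, egfTerm_momentSeries, openMoment_succ, egfTerm_one_add_X_mul,
    map_add, map_sum]
  simp only [map_smul, egfTerm_powSumOp, egfTerm_momentSeries]

/-- The exponential generating function of the Bell numbers. -/
noncomputable def bellSeries : ℚ⟦X⟧ := PowerSeries.mk fun n => (Nat.bell n : ℚ) / n.factorial

/-- This is the binomial recurrence of the Bell numbers. -/
theorem derivative_bellSeries : d⁄dX ℚ bellSeries = exp ℚ * bellSeries := by
  ext n
  rw [coeff_derivative, bellSeries, coeff_mk, coeff_mul, Nat.bell_succ', Nat.factorial_succ]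
  push_cast
  rw [div_mul_eq_mul_div, mul_comm ((n : ℚ) + 1), mul_div_mul_right _ _ (by positivity), sum_div]
  refine sum_congr rfl fun p hp => ?_
  rw [coeff_exp, coeff_mk]
  have h := mem_antidiagonal.1 hp
  subst h
  rw [Nat.choose_symm_add, Nat.add_choose,
    Nat.cast_div (Nat.factorial_mul_factorial_dvd_factorial_add _ _) (by positivity)]
  have := Nat.factorial_ne_zero (p.1 + p.2)
  simp only [Algebra.algebraMap_self, RingHom.id_apply]
  push_cast
  field_simp

/-- The series `B(z) * exp (w * (exp z - 1))` with `B` the exponential generating function of the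
Bell numbers. -/
noncomputable def baseSeries : ℚ⟦X⟧⟦X⟧ :=
  PowerSeries.mk fun h => C (1 / h.factorial : ℚ) * (exp ℚ - 1) ^ h * bellSeries

theorem C_one_div_factorial_succ_mul (h : ℕ) :
    (C (1 / (h + 1).factorial : ℚ) : ℚ⟦X⟧) * (h + 1) = C (1 / h.factorial : ℚ) := by
  rw [show (h : ℚ⟦X⟧) + 1 = C ((h : ℚ) + 1) by simp, ← map_mul, Nat.factorial_succ]
  push_cast
  congr 1
  field_simp

theorem derivative_baseSeries :
    d⁄dX ℚ⟦X⟧ baseSeries = C (exp ℚ - 1) * baseSeries := by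
  ext1 h
  rw [coeff_derivative, coeff_C_mul, baseSeries, coeff_mk, coeff_mk,
    ← C_one_div_factorial_succ_mul h, pow_succ]
  ring

theorem coeffDerivative_baseSeries :
    coeffDerivative baseSeries = (1 + X) * C (exp ℚ) * baseSeries := by
  ext1 h
  rw [coeff_coeffDerivative, mul_assoc, add_mul, one_mul, map_add, mul_left_comm, coeff_C_mul,
    coeff_C_mul]
  cases h with
  | zero => simp [baseSeries, derivative_bellSeries]
  | succ h =>
    rw [coeff_succ_X_mul, baseSeries, coeff_mk, coeff_mk, derivative_mul, derivative_mul,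
      derivative_C, derivative_pow, derivative_bellSeries, derivative_sub, derivative_exp,
      derivative_one, ← C_one_div_factorial_succ_mul h]
    push_cast
    ring

theorem egfTerm_zero_baseSeries : egfTerm 0 baseSeries = 1 := by
  rw [egfTerm_zero]
  ext h
  rw [coeff_map, baseSeries, coeff_mk, coeff_one]
  cases h with
  | zero => simp [bellSeries, ← coeff_zero_eq_constantCoeff_apply]
  | succ h => simp

theorem momentSeries_zero : momentSeries 0 = baseSeries := by
  rw [← sub_eq_zero]
  refine eq_zero_of_coeffDerivative_eq ?_ ?_
  · rw [map_sub, coeffDerivative_momentSeries, coeffDerivative_baseSeries, derivative_sub,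
      derivative_baseSeries]
    simp [powSumOp_zero]
    ring
  · rw [map_sub, egfTerm_momentSeries, openMoment_zero, egfTerm_zero_baseSeries]
    simp

/-- `baseSeries` solves the homogeneous equation, so the product rule leaves for `g` only transport
and the source `S` coming from lower moments; uniqueness concludes. -/
theorem momentSeries_eq_mul_baseSeries {k : ℕ} (hk : k ≠ 0) {g S : ℚ⟦X⟧⟦X⟧}
    (hS : ∑ j ∈ range k, (k.choose (j + 1) : ℚ) •
      powSumOp ℚ⟦X⟧ (j + 1) (momentSeries (k - (j + 1))) = S * baseSeries)
    (hg : coeffDerivative g = (1 + X) * (d⁄dX ℚ⟦X⟧ g + S)) (h0 : egfTerm 0 g = 0) :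
    momentSeries k = g * baseSeries := by
  rw [← sub_eq_zero]
  refine eq_zero_of_coeffDerivative_eq ?_ ?_
  · rw [map_sub, coeffDerivative_momentSeries, sum_range_succ', hS, Derivation.leibniz,
      coeffDerivative_baseSeries, derivative_sub, derivative_mul, derivative_baseSeries, hg]
    simp [powSumOp_zero]
    ring
  · rw [map_sub, egfTerm_momentSeries, openMoment_zero, egfTerm_zero_mul, h0]
    simp [hk]

/-- The derivative with respect to `w`, conjugated by `baseSeries`. -/
noncomputable def twist (f : ℚ⟦X⟧⟦X⟧) : ℚ⟦X⟧⟦X⟧ := d⁄dX ℚ⟦X⟧ f + C (exp ℚ - 1) * f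

theorem iterate_derivative_mul_baseSeries (i : ℕ) (g : ℚ⟦X⟧⟦X⟧) :
    (d⁄dX ℚ⟦X⟧)^[i] (g * baseSeries) =
      twist^[i] g * baseSeries := by
  induction i generalizing g with
  | zero => rfl
  | succ i ih =>
    rw [Function.iterate_succ_apply, Function.iterate_succ_apply, ← ih, derivative_mul,
      derivative_baseSeries]
    congr 1
    simp only [twist]
    ring

end GeneratingFunction

end SetPartition

namespace SetPartition

open Finset PowerSeries

/-! ### Solving the transport equation by exponential monomials -/

section Solution

/-- The series `z ^ b * exp (s * z) * (1 + w) ^ l`. -/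
noncomputable def expMonomial (b s l : ℕ) : ℚ⟦X⟧⟦X⟧ :=
  C (X ^ b * exp ℚ ^ s) * (1 + X) ^ l

/-- The combinations of the series `z ^ b * exp (s * z) * (1 + w) ^ l` with `b ≤ a`, `s ≤ S` and
`l ≤ L`. -/
noncomputable def expSpan (a S L : ℕ) : Submodule ℚ ℚ⟦X⟧⟦X⟧ :=
  Submodule.span ℚ {f | ∃ b ≤ a, ∃ s ≤ S, ∃ l ≤ L, f = expMonomial b s l}

variable {a a' S S' L L' : ℕ} {f g : ℚ⟦X⟧⟦X⟧}

theorem expMonomial_mem {b s l : ℕ} (hb : b ≤ a) (hs : s ≤ S) (hl : l ≤ L) :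
    expMonomial b s l ∈ expSpan a S L :=
  Submodule.subset_span ⟨b, hb, s, hs, l, hl, rfl⟩

theorem expSpan_induction {p : ℚ⟦X⟧⟦X⟧ → Prop}
    (hm : ∀ b ≤ a, ∀ s ≤ S, ∀ l ≤ L, p (expMonomial b s l)) (h0 : p 0)
    (hadd : ∀ f g, p f → p g → p (f + g)) (hsmul : ∀ (r : ℚ) f, p f → p (r • f))
    (hf : f ∈ expSpan a S L) : p f := by
  refine Submodule.span_induction ?_ h0 (fun f g _ _ => hadd f g) (fun r f _ => hsmul r f) hf
  rintro _ ⟨b, hb, s, hs, l, hl, rfl⟩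
  exact hm b hb s hs l hl

theorem expSpan_mono (ha : a ≤ a') (hS : S ≤ S') (hL : L ≤ L') :
    expSpan a S L ≤ expSpan a' S' L' := by
  refine Submodule.span_mono ?_
  rintro _ ⟨b, hb, s, hs, l, hl, rfl⟩
  exact ⟨b, hb.trans ha, s, hs.trans hS, l, hl.trans hL, rfl⟩

theorem expMonomial_zero : expMonomial 0 0 0 = 1 := by simp [expMonomial]

theorem one_mem_expSpan : (1 : ℚ⟦X⟧⟦X⟧) ∈ expSpan a S L := by
  rw [← expMonomial_zero]
  exact expMonomial_mem (Nat.zero_le _) (Nat.zero_le _) (Nat.zero_le _)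

theorem one_add_X_mul_expMonomial (b s l : ℕ) :
    (1 + X) * expMonomial b s l = expMonomial b s (l + 1) := by
  simp only [expMonomial, pow_succ]
  ring

theorem X_mul_expMonomial (b s l : ℕ) :
    X * expMonomial b s l = expMonomial b s (l + 1) - expMonomial b s l := by
  rw [← one_add_X_mul_expMonomial]
  ring

theorem C_exp_sub_one_mul_expMonomial (b s l : ℕ) :
    C (exp ℚ - 1) * expMonomial b s l = expMonomial b (s + 1) l - expMonomial b s l := by
  simp only [expMonomial, pow_succ, map_mul, map_sub, map_one]
  ring

theorem one_add_X_mul_mem (hf : f ∈ expSpan a S L) : (1 + X) * f ∈ expSpan a S (L + 1) := by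
  refine expSpan_induction (p := fun f => (1 + X) * f ∈ expSpan a S (L + 1))
    (fun b hb s hs l hl => ?_) ?_ (fun f g hf hg => ?_) (fun r f hf => ?_) hf
  · rw [one_add_X_mul_expMonomial]
    exact expMonomial_mem hb hs (by omega)
  · simp
  · rw [mul_add]
    exact add_mem hf hg
  · rw [mul_smul_comm]
    exact Submodule.smul_mem _ r hf

theorem X_mul_mem (hf : f ∈ expSpan a S L) : X * f ∈ expSpan a S (L + 1) := by
  rw [← add_sub_cancel_left 1 X, sub_mul, one_mul]
  exact sub_mem (one_add_X_mul_mem hf) (expSpan_mono le_rfl le_rfl (by omega) hf)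

theorem X_pow_mul_mem (i : ℕ) (hf : f ∈ expSpan a S L) : X ^ i * f ∈ expSpan a S (L + i) := by
  induction i with
  | zero => simpa using hf
  | succ i ih =>
    rw [pow_succ', mul_assoc]
    exact X_mul_mem ih

theorem C_exp_sub_one_mul_mem (hf : f ∈ expSpan a S L) :
    C (exp ℚ - 1) * f ∈ expSpan a (S + 1) L := by
  refine expSpan_induction (p := fun f => C (exp ℚ - 1) * f ∈ expSpan a (S + 1) L)
    (fun b hb s hs l hl => ?_) ?_ (fun f g hf hg => ?_) (fun r f hf => ?_) hf
  · rw [C_exp_sub_one_mul_expMonomial]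
    exact sub_mem (expMonomial_mem hb (by omega) hl) (expMonomial_mem hb (by omega) hl)
  · simp
  · rw [mul_add]
    exact add_mem hf hg
  · rw [mul_smul_comm]
    exact Submodule.smul_mem _ r hf

theorem derivative_one_add_X_pow (l : ℕ) :
    d⁄dX ℚ⟦X⟧ ((1 + X) ^ l) = (l : ℚ⟦X⟧⟦X⟧) * (1 + X) ^ (l - 1) := by
  rw [derivative_pow, show d⁄dX ℚ⟦X⟧ (1 + X) = 1 by
    rw [derivative_add, derivative_one, derivative_X, zero_add], mul_one]

theorem derivative_expMonomial (b s l : ℕ) :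
    d⁄dX ℚ⟦X⟧ (expMonomial b s l) = (l : ℚ) • expMonomial b s (l - 1) := by
  rw [expMonomial, derivative_mul, derivative_C, derivative_one_add_X_pow, mul_zero, add_zero,
    expMonomial, Nat.cast_smul_eq_nsmul, nsmul_eq_mul]
  ring

theorem derivative_exp_pow (s : ℕ) : d⁄dX ℚ (exp ℚ ^ s) = s * exp ℚ ^ s := by
  rw [derivative_pow, derivative_exp]
  cases s with
  | zero => simp
  | succ s =>
    rw [Nat.add_sub_cancel]
    ring

theorem coeffDerivative_expMonomial (b s l : ℕ) :
    coeffDerivative (expMonomial b s l) =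
      (b : ℚ) • expMonomial (b - 1) s l + (s : ℚ) • expMonomial b s l := by
  have h : coeffDerivative ((1 + X : ℚ⟦X⟧⟦X⟧) ^ l) = 0 := by
    rw [Derivation.leibniz_pow, map_add, coeffDerivative_X, Derivation.map_one_eq_zero]
    simp
  rw [expMonomial, Derivation.leibniz, h, coeffDerivative_C, derivative_mul, derivative_exp_pow,
    derivative_pow, derivative_X]
  simp only [expMonomial, Nat.cast_smul_eq_nsmul, nsmul_eq_mul, smul_eq_mul, map_mul, map_add,
    map_natCast, map_pow, mul_one]
  ring

theorem egfTerm_zero_expMonomial (b s l : ℕ) :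
    egfTerm 0 (expMonomial b s l) = if b = 0 then (1 + X) ^ l else 0 := by
  rw [egfTerm_zero, expMonomial]
  split_ifs with hb
  · simp [hb]
  · simp [hb]

theorem derivative_mem (hf : f ∈ expSpan a S L) : d⁄dX ℚ⟦X⟧ f ∈ expSpan a S L := by
  refine expSpan_induction (p := fun f => d⁄dX ℚ⟦X⟧ f ∈ expSpan a S L)
    (fun b hb s hs l hl => ?_) ?_ (fun f g hf hg => ?_) (fun r f hf => ?_) hf
  · rw [derivative_expMonomial]
    exact Submodule.smul_mem _ _ (expMonomial_mem hb hs (by omega))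
  · rw [derivative_zero]
    exact zero_mem _
  · rw [derivative_add]
    exact add_mem hf hg
  · rw [derivative_ratSmul]
    exact Submodule.smul_mem _ r hf

theorem iterate_mem (i : ℕ) (hf : f ∈ expSpan a S L) :
    twist^[i] f ∈ expSpan a (S + i) L := by
  induction i generalizing f S with
  | zero => exact hf
  | succ i ih =>
    rw [Function.iterate_succ_apply, show S + (i + 1) = S + 1 + i by ring]
    exact ih (add_mem (expSpan_mono le_rfl (by omega) le_rfl (derivative_mem hf))
      (C_exp_sub_one_mul_mem hf))

theorem exists_powSumOp_eq_mul_baseSeries (j : ℕ) (hg : g ∈ expSpan a S L) :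
    ∃ g' ∈ expSpan a (S + j + 1) (L + j),
      powSumOp ℚ⟦X⟧ j (g * baseSeries) = g' * baseSeries := by
  obtain ⟨b, hb⟩ := exists_sum_pow_eq_sum_descFactorial j
  refine ⟨∑ i ∈ range (j + 1), b i •
    (X ^ i * twist^[i + 1] g), ?_, ?_⟩
  · refine sum_mem fun i hi => Submodule.smul_mem _ _ ?_
    have := mem_range.1 hi
    exact expSpan_mono le_rfl (by omega) (by omega) (X_pow_mul_mem i (iterate_mem (i + 1) hg))
  · rw [powSumOp_eq hb, sum_mul]
    refine sum_congr rfl fun i _ => ?_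
    rw [iterate_derivative_mul_baseSeries, smul_mul_assoc, mul_assoc]

theorem twist_expMonomial (b s l : ℕ) :
    twist (expMonomial b s l) =
      (l : ℚ) • expMonomial b s (l - 1) + (expMonomial b (s + 1) l - expMonomial b s l) := by
  rw [twist, derivative_expMonomial, C_exp_sub_one_mul_expMonomial]

theorem twist_add (f g : ℚ⟦X⟧⟦X⟧) : twist (f + g) = twist f + twist g := by
  rw [twist, derivative_add, twist, twist]
  ring

theorem twist_sub (f g : ℚ⟦X⟧⟦X⟧) : twist (f - g) = twist f - twist g := by
  rw [twist, derivative_sub, twist, twist]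
  ring

theorem twist_smul (r : ℚ) (f : ℚ⟦X⟧⟦X⟧) : twist (r • f) = r • twist f := by
  rw [twist, derivative_ratSmul, twist, mul_smul_comm, smul_add]

theorem one_add_X_mul_derivative_expMonomial (b s l : ℕ) :
    (1 + X) * d⁄dX ℚ⟦X⟧ (expMonomial b s l) = (l : ℚ) • expMonomial b s l := by
  rw [derivative_expMonomial]
  cases l with
  | zero => simp
  | succ l =>
    rw [mul_smul_comm, Nat.add_sub_cancel, one_add_X_mul_expMonomial]

/-- A solution of the inhomogeneous transport equation with zero initial condition. -/
def IsTransportSolution (g T : ℚ⟦X⟧⟦X⟧) : Prop :=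
  coeffDerivative g = (1 + X) * d⁄dX ℚ⟦X⟧ g + T ∧ egfTerm 0 g = 0

theorem IsTransportSolution.add {g g' T T' : ℚ⟦X⟧⟦X⟧} (h : IsTransportSolution g T)
    (h' : IsTransportSolution g' T') : IsTransportSolution (g + g') (T + T') := by
  refine ⟨?_, by rw [map_add, h.2, h'.2, add_zero]⟩
  rw [map_add, h.1, h'.1, derivative_add]
  ring

theorem IsTransportSolution.smul {g T : ℚ⟦X⟧⟦X⟧} (h : IsTransportSolution g T) (r : ℚ) :
    IsTransportSolution (r • g) (r • T) := by
  refine ⟨?_, by rw [map_smul, h.2, smul_zero]⟩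
  rw [Derivation.map_smul, h.1, derivative_ratSmul, mul_smul_comm, smul_add]

/-- In the resonant case `s = l` one integrates in `z`, raising `b`. Otherwise one divides by `s -
l` and recursively removes the term of lower `b`. -/
theorem exists_isTransportSolution_expMonomial {N b s l : ℕ} (hs : s ≤ N) (hl : l ≤ N) :
    ∃ g ∈ expSpan (b + 1) N N, IsTransportSolution g (expMonomial b s l) := by
  by_cases hsl : s = l
  · subst hsl
    refine ⟨((b : ℚ) + 1)⁻¹ • expMonomial (b + 1) s s,
      Submodule.smul_mem _ _ (expMonomial_mem le_rfl hs hl), ?_, ?_⟩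
    · rw [Derivation.map_smul, coeffDerivative_expMonomial,
        derivative_ratSmul,
        mul_smul_comm, one_add_X_mul_derivative_expMonomial, smul_add, smul_smul, add_comm,
        Nat.cast_succ, inv_mul_cancel₀ (by positivity), one_smul, Nat.add_sub_cancel]
    · rw [map_smul, egfTerm_zero_expMonomial, if_neg (Nat.succ_ne_zero b), smul_zero]
  · have hc : (s : ℚ) - l ≠ 0 := sub_ne_zero.2 (Nat.cast_injective.ne hsl)
    -- For `c = 0` the truncated exponent `c - 1` is harmless, as its coefficient vanishes.
    have hop : ∀ c : ℕ, coeffDerivative (expMonomial c s l) =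
        (1 + X) * d⁄dX ℚ⟦X⟧ (expMonomial c s l) +
          ((c : ℚ) • expMonomial (c - 1) s l + ((s : ℚ) - l) • expMonomial c s l) := fun c => by
      rw [coeffDerivative_expMonomial, one_add_X_mul_derivative_expMonomial, sub_smul]
      ring
    induction b with
    | zero =>
      -- The subtracted monomial solves the homogeneous equation and restores the zero initial
      -- condition. It has exponent `l` in place of `s`, hence the common bound `N` for both.
      have h1 : IsTransportSolution (expMonomial 0 s l - expMonomial 0 l l)
          (((s : ℚ) - l) • expMonomial 0 s l) := by
        refine ⟨?_, by simp [egfTerm_zero_expMonomial]⟩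
        rw [map_sub, hop, derivative_sub, coeffDerivative_expMonomial, mul_sub,
          one_add_X_mul_derivative_expMonomial 0 l l]
        simp only [Nat.cast_zero, zero_smul]
        ring
      refine ⟨((s : ℚ) - l)⁻¹ • (expMonomial 0 s l - expMonomial 0 l l),
        Submodule.smul_mem _ _ (sub_mem (expMonomial_mem (by omega) hs hl)
          (expMonomial_mem (by omega) hl hl)), ?_⟩
      have := h1.smul ((s : ℚ) - l)⁻¹
      rwa [smul_smul, inv_mul_cancel₀ hc, one_smul] at this
    | succ b ih =>
      obtain ⟨g, hg, hgs⟩ := ih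
      have h1 : IsTransportSolution (expMonomial (b + 1) s l)
          (((b : ℚ) + 1) • expMonomial b s l + ((s : ℚ) - l) • expMonomial (b + 1) s l) := by
        refine ⟨?_, by simp [egfTerm_zero_expMonomial]⟩
        rw [hop, Nat.cast_succ, Nat.add_sub_cancel]
      refine ⟨((s : ℚ) - l)⁻¹ • (expMonomial (b + 1) s l + (-((b : ℚ) + 1)) • g),
        Submodule.smul_mem _ _ (add_mem (expMonomial_mem (by omega) hs hl)
          (Submodule.smul_mem _ _ (expSpan_mono (by omega) le_rfl le_rfl hg))), ?_⟩
      have := (h1.add (hgs.smul (-((b : ℚ) + 1)))).smul ((s : ℚ) - l)⁻¹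
      rwa [neg_smul _ (expMonomial b s l), add_neg_cancel_comm, smul_smul, inv_mul_cancel₀ hc, one_smul] at this

theorem exists_isTransportSolution {N : ℕ} {T : ℚ⟦X⟧⟦X⟧} (hT : T ∈ expSpan a N N) :
    ∃ g ∈ expSpan (a + 1) N N, IsTransportSolution g T := by
  refine expSpan_induction (p := fun T => ∃ g ∈ expSpan (a + 1) N N, IsTransportSolution g T)
    (fun b hb s hs l hl => ?_) ?_ (fun f g hf hg => ?_) (fun r f hf => ?_) hT
  · obtain ⟨g, hg, h⟩ := exists_isTransportSolution_expMonomial (b := b) hs hl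
    exact ⟨g, expSpan_mono (by omega) le_rfl le_rfl hg, h⟩
  · exact ⟨0, zero_mem _, by
      rw [IsTransportSolution, map_zero, map_zero]
      simp⟩
  · obtain ⟨f', hf', h⟩ := hf
    obtain ⟨g', hg', h'⟩ := hg
    exact ⟨f' + g', add_mem hf' hg', h.add h'⟩
  · obtain ⟨f', hf', h⟩ := hf
    exact ⟨r • f', Submodule.smul_mem _ r hf', h.smul r⟩

theorem exists_momentSeries_eq (k : ℕ) :
    ∃ g ∈ expSpan k (2 * k) (2 * k), momentSeries k = g * baseSeries := by
  induction k using Nat.strong_induction_on with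
  | _ k ih =>
    rcases Nat.eq_zero_or_pos k with rfl | hk
    · exact ⟨1, one_mem_expSpan, by rw [momentSeries_zero, one_mul]⟩
    -- From the moment of order `k - (j + 1)` the operator reaches `s ≤ 2 * k - j` and `l ≤ 2 * k -
    -- j - 1`; the bound on `l` leaves room for the factor `1 + X`.
    · have hsrc : ∀ j ∈ range k, ∃ g' ∈ expSpan (k - 1) (2 * k) (2 * k - 1),
          powSumOp ℚ⟦X⟧ (j + 1) (momentSeries (k - (j + 1))) = g' * baseSeries := by
        intro j hj
        have := mem_range.1 hj
        obtain ⟨g, hg, h⟩ := ih (k - (j + 1)) (by omega)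
        obtain ⟨g', hg', h'⟩ := exists_powSumOp_eq_mul_baseSeries (j + 1) hg
        exact ⟨g', expSpan_mono (by omega) (by omega) (by omega) hg', by rw [h, h']⟩
      choose! g' hg' h' using hsrc
      have hT : (1 + X) * ∑ j ∈ range k, (k.choose (j + 1) : ℚ) • g' j ∈
          expSpan (k - 1) (2 * k) (2 * k) := by
        have := one_add_X_mul_mem (sum_mem fun j hj =>
          Submodule.smul_mem _ (k.choose (j + 1) : ℚ) (hg' j hj))
        rwa [Nat.sub_add_cancel (by omega)] at this
      obtain ⟨g, hg, h1, h2⟩ := exists_isTransportSolution hT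
      rw [Nat.sub_add_cancel hk] at hg
      refine ⟨g, hg, momentSeries_eq_mul_baseSeries hk.ne' ?_ (by rw [h1, mul_add]) h2⟩
      rw [sum_mul]
      refine sum_congr rfl fun j hj => ?_
      rw [h' j hj, smul_mul_assoc]

end Solution

/-! ### From exponential monomials to shifted Bell numbers -/

section BellCombinations

/-- The `n`-th term of the sequence with a given exponential generating function. -/
noncomputable def seqTerm (n : ℕ) : ℚ⟦X⟧ →ₗ[ℚ] ℚ := (n.factorial : ℚ) • coeff n

theorem seqTerm_apply (n : ℕ) (f : ℚ⟦X⟧) : seqTerm n f = n.factorial * coeff n f := rfl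

theorem seqTerm_derivative (n : ℕ) (f : ℚ⟦X⟧) : seqTerm n (d⁄dX ℚ f) = seqTerm (n + 1) f := by
  rw [seqTerm_apply, seqTerm_apply, coeff_derivative, Nat.factorial_succ]
  push_cast
  ring

theorem seqTerm_X_pow_mul (n b : ℕ) (f : ℚ⟦X⟧) :
    seqTerm n (X ^ b * f) = (n.descFactorial b : ℕ) * seqTerm (n - b) f := by
  rw [seqTerm_apply, seqTerm_apply, coeff_X_pow_mul']
  split_ifs with h
  · rw [← Nat.factorial_mul_descFactorial h]
    push_cast
    ring
  · rw [Nat.descFactorial_of_lt (by omega)]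
    simp

theorem seqTerm_exp_pow_mul_bellSeries_succ (n s : ℕ) :
    seqTerm n (exp ℚ ^ (s + 1) * bellSeries) =
      seqTerm (n + 1) (exp ℚ ^ s * bellSeries) - s * seqTerm n (exp ℚ ^ s * bellSeries) := by
  rw [← seqTerm_derivative, derivative_mul, derivative_exp_pow, derivative_bellSeries, map_add,
    show bellSeries * (s * exp ℚ ^ s) = (s : ℚ) • (exp ℚ ^ s * bellSeries) by
      rw [Nat.cast_smul_eq_nsmul, nsmul_eq_mul]
      ring, map_smul, smul_eq_mul, ← mul_assoc, ← pow_succ]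
  ring

theorem seqTerm_bellSeries (n : ℕ) : seqTerm n bellSeries = Nat.bell n := by
  rw [seqTerm_apply, bellSeries, coeff_mk, mul_div_cancel₀ _ (Nat.cast_ne_zero.2 n.factorial_ne_zero)]

theorem exists_seqTerm_exp_pow_mul_bellSeries (s : ℕ) :
    ∃ c : ℕ → ℚ, (∀ i, s < i → c i = 0) ∧
      ∀ n, seqTerm n (exp ℚ ^ s * bellSeries) = ∑ i ∈ range (s + 1), c i * Nat.bell (n + i) := by
  induction s with
  | zero => exact ⟨fun i => if i = 0 then 1 else 0, fun i hi => by simp; omega,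
      by simp [seqTerm_bellSeries]⟩
  | succ s ih =>
    obtain ⟨c, hc, h⟩ := ih
    -- The coefficients follow `exp ((s + 1) * z) * B = (exp (s * z) * B)' - s * exp (s * z) * B`,
    -- where differentiation shifts the sequence.
    refine ⟨fun i => (if i = 0 then 0 else c (i - 1)) - s * c i, fun i hi => ?_, fun n => ?_⟩
    · simp only
      rw [hc i (by omega), if_neg (by omega), hc (i - 1) (by omega)]
      simp
    · simp only [sub_mul]
      rw [sum_sub_distrib, sum_range_succ (fun i => s * c i * _), hc (s + 1) (by omega),
        sum_range_succ' (fun i => (if i = 0 then (0 : ℚ) else c (i - 1)) * _),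
        seqTerm_exp_pow_mul_bellSeries_succ, h, h, mul_sum]
      simp only [if_true, zero_mul, add_zero, mul_zero, Nat.add_sub_cancel, Nat.succ_ne_zero,
        if_false]
      congr 1
      · exact sum_congr rfl fun i _ => by rw [add_right_comm, add_assoc]
      · exact sum_congr rfl fun i _ => by ring

/-- The sequences that are combinations of shifted Bell numbers with polynomial coefficients, with
the shifts between `-k` and `2 * k`, and with the coefficient of the shift by `2 * k - j` of degree
at most `j`. -/
def IsBellCombination (k : ℕ) (u : ℕ → ℚ) : Prop :=
  ∃ Q : ℤ → Polynomial ℚ,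
    (∀ j : ℕ, j ≤ 3 * k → (Q (2 * (k : ℤ) - (j : ℤ))).natDegree ≤ j) ∧
    ∀ n : ℕ, u n = ∑ m ∈ Icc (-(k : ℤ)) (2 * (k : ℤ)), (Q m).eval (n : ℚ) * bell ((n : ℤ) + m)

variable {k : ℕ} {u v : ℕ → ℚ}

theorem IsBellCombination.zero : IsBellCombination k fun _ => 0 :=
  ⟨fun _ => 0, by simp, by simp⟩

theorem IsBellCombination.add (hu : IsBellCombination k u) (hv : IsBellCombination k v) :
    IsBellCombination k fun n => u n + v n := by
  obtain ⟨Q, hQ, hu⟩ := hu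
  obtain ⟨Q', hQ', hv⟩ := hv
  refine ⟨fun m => Q m + Q' m,
    fun j hj => (Polynomial.natDegree_add_le _ _).trans (max_le (hQ j hj) (hQ' j hj)), fun n => ?_⟩
  simp only [hu, hv, Polynomial.eval_add, add_mul, sum_add_distrib]

theorem IsBellCombination.const_mul (r : ℚ) (hu : IsBellCombination k u) :
    IsBellCombination k fun n => r * u n := by
  obtain ⟨Q, hQ, hu⟩ := hu
  refine ⟨fun m => Polynomial.C r * Q m,
    fun j hj => (Polynomial.natDegree_C_mul_le _ _).trans (hQ j hj), fun n => ?_⟩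
  simp only [hu, Polynomial.eval_mul, Polynomial.eval_C, mul_sum, mul_assoc]

theorem IsBellCombination.sum {ι : Type*} {s : Finset ι} {u : ι → ℕ → ℚ}
    (hu : ∀ i ∈ s, IsBellCombination k (u i)) : IsBellCombination k fun n => ∑ i ∈ s, u i n := by
  classical
  induction s using Finset.induction_on with
  | empty => simpa using IsBellCombination.zero
  | insert i s hi ih =>
    simp only [sum_insert hi]
    exact (hu i (mem_insert_self _ _)).add (ih fun j hj => hu j (mem_insert_of_mem hj))

/-- The shift `i - b` equals `2 * k - j` for `j = 2 * k - i + b`, which is at least the degree `b`.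
-/
theorem isBellCombination_descFactorial_mul {b i : ℕ} (hb : b ≤ k) (hi : i ≤ 2 * k) :
    IsBellCombination k fun n => (n.descFactorial b : ℕ) * Nat.bell (n - b + i) := by
  refine ⟨fun m => if m = (i : ℤ) - b then descPochhammer ℚ b else 0, fun j _ => ?_, fun n => ?_⟩
  · simp only
    split_ifs with h
    · rw [descPochhammer_natDegree]
      omega
    · simp
  · rw [sum_eq_single_of_mem ((i : ℤ) - b) (by rw [mem_Icc]; omega)
      (fun m _ hm => by simp [hm])]
    dsimp only
    rw [if_pos rfl, descPochhammer_eval_eq_descFactorial]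
    rcases le_or_gt b n with hbn | hbn
    · rw [bell, if_pos (by omega), show ((n : ℤ) + (i - b)).toNat = n - b + i by omega]
    -- For `n < b` the falling factorial vanishes, so neither the truncated `n - b` nor the value of
    -- `bell` matters.
    · rw [Nat.descFactorial_of_lt hbn]
      simp

theorem constantCoeff_momentSeries (k n : ℕ) :
    seqTerm n (constantCoeff (momentSeries k)) = moment k n := by
  rw [← constantCoeff_openMoment, ← egfTerm_momentSeries, ← coeff_zero_eq_constantCoeff_apply,
    ← coeff_zero_eq_constantCoeff_apply, coeff_egfTerm, seqTerm_apply]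

theorem constantCoeff_expMonomial_mul_baseSeries (b s l : ℕ) :
    constantCoeff (expMonomial b s l * baseSeries) = X ^ b * (exp ℚ ^ s * bellSeries) := by
  have : constantCoeff baseSeries = bellSeries := by
    rw [← coeff_zero_eq_constantCoeff_apply, baseSeries, coeff_mk]
    simp
  rw [map_mul, this, expMonomial]
  simp [mul_assoc]

theorem isBellCombination_moment (k : ℕ) : IsBellCombination k (moment k) := by
  obtain ⟨g, hg, h⟩ := exists_momentSeries_eq k
  suffices H : IsBellCombination k fun n => seqTerm n (constantCoeff (g * baseSeries)) by
    simpa only [← h, constantCoeff_momentSeries] using H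
  refine expSpan_induction (p := fun g => IsBellCombination k fun n =>
    seqTerm n (constantCoeff (g * baseSeries))) (fun b hb s hs l hl => ?_) ?_
    (fun f g hf hg => ?_) (fun r f hf => ?_) hg
  · obtain ⟨c, -, hc⟩ := exists_seqTerm_exp_pow_mul_bellSeries s
    simp only [constantCoeff_expMonomial_mul_baseSeries, seqTerm_X_pow_mul, hc, mul_sum]
    refine IsBellCombination.sum fun i hi => ?_
    have := mem_range.1 hi
    have := (isBellCombination_descFactorial_mul (k := k) (b := b) (i := i) hb
      (by omega)).const_mul (c i)
    simpa only [mul_left_comm] using this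
  · simpa using IsBellCombination.zero
  · simp only [add_mul, map_add]
    exact hf.add hg
  · have : ∀ n, seqTerm n (constantCoeff (r • f * baseSeries)) =
        r * seqTerm n (constantCoeff (f * baseSeries)) := fun n => by
      rw [smul_mul_assoc, map_rat_smul, map_rat_smul, smul_eq_mul]
    simp only [this]
    exact hf.const_mul r

end BellCombinations

end SetPartition

namespace SetPartition

open Finset PowerSeries

/-! ### The first two moments -/

section ExplicitMoments

theorem powSumOp_one {R : Type*} [CommRing R] [Algebra ℚ R] (f : R⟦X⟧) :
    powSumOp R 1 f = (1 / 2 : ℚ) • (X * (d⁄dX R)^[2] f) := by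
  rw [powSumOp_eq (b := fun i => if i = 1 then 1 / 2 else 0) fun m => ?_]
  · simp
  · induction m with
    | zero => simp
    | succ m ih =>
      rw [sum_range_succ, ih]
      simp only [sum_range_succ, range_zero, sum_empty, cast_descFactorial_succ,
        Nat.descFactorial_zero]
      push_cast
      norm_num
      ring

theorem powSumOp_two {R : Type*} [CommRing R] [Algebra ℚ R] (f : R⟦X⟧) :
    powSumOp R 2 f =
      (1 / 2 : ℚ) • (X * (d⁄dX R)^[2] f) + (1 / 3 : ℚ) • (X ^ 2 * (d⁄dX R)^[3] f) := by
  rw [powSumOp_eq (b := fun i => if i = 1 then 1 / 2 else if i = 2 then 1 / 3 else 0) fun m => ?_]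
  · simp [sum_range_succ]
  · induction m with
    | zero => simp
    | succ m ih =>
      rw [sum_range_succ, ih]
      simp only [sum_range_succ, range_zero, sum_empty, cast_descFactorial_succ,
        Nat.descFactorial_zero]
      push_cast
      norm_num
      ring

/-- The quotient of the generating function of the first moments by `baseSeries`. -/
noncomputable def firstMomentFactor : ℚ⟦X⟧⟦X⟧ :=
  (1/2 : ℚ) • expMonomial 0 0 1 + (-1/4 : ℚ) • expMonomial 0 0 2 +
    (1 : ℚ) • expMonomial 0 1 2 + (-1/2 : ℚ) • expMonomial 0 2 1 +
    (-3/4 : ℚ) • expMonomial 0 2 2 + (1 : ℚ) • expMonomial 1 1 1 +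
    (1/2 : ℚ) • expMonomial 1 2 2

/-- The quotient of the generating function of the second moments by `baseSeries`. -/
noncomputable def secondMomentFactor : ℚ⟦X⟧⟦X⟧ :=
  (-2/3 : ℚ) • expMonomial 0 0 1 + (11/12 : ℚ) • expMonomial 0 0 2 +
    (-17/36 : ℚ) • expMonomial 0 0 3 + (1/16 : ℚ) • expMonomial 0 0 4 +
    (-2 : ℚ) • expMonomial 0 1 1 + (-3 : ℚ) • expMonomial 0 1 2 +
    (3 : ℚ) • expMonomial 0 1 3 + (-1/2 : ℚ) • expMonomial 0 1 4 +
    (2 : ℚ) • expMonomial 0 2 1 + (-3/2 : ℚ) • expMonomial 0 2 2 +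
    (-9/2 : ℚ) • expMonomial 0 2 3 + (11/8 : ℚ) • expMonomial 0 2 4 +
    (2/3 : ℚ) • expMonomial 0 3 1 + (10/3 : ℚ) • expMonomial 0 3 2 +
    (11/9 : ℚ) • expMonomial 0 3 3 + (-3/2 : ℚ) • expMonomial 0 3 4 +
    (1/4 : ℚ) • expMonomial 0 4 2 + (3/4 : ℚ) • expMonomial 0 4 3 +
    (9/16 : ℚ) • expMonomial 0 4 4 + (-1 : ℚ) • expMonomial 1 1 1 +
    (3 : ℚ) • expMonomial 1 1 2 + (-1/2 : ℚ) • expMonomial 1 1 3 +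
    (-3 : ℚ) • expMonomial 1 2 1 + (-5 : ℚ) • expMonomial 1 2 2 +
    (9/2 : ℚ) • expMonomial 1 2 3 + (-1/4 : ℚ) • expMonomial 1 2 4 +
    (-3 : ℚ) • expMonomial 1 3 2 + (-25/6 : ℚ) • expMonomial 1 3 3 +
    (1 : ℚ) • expMonomial 1 3 4 + (-1/2 : ℚ) • expMonomial 1 4 3 +
    (-3/4 : ℚ) • expMonomial 1 4 4 + (1 : ℚ) • expMonomial 2 1 1 +
    (7/2 : ℚ) • expMonomial 2 2 2 + (2 : ℚ) • expMonomial 2 3 3 +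
    (1/4 : ℚ) • expMonomial 2 4 4

/-- The coefficients of the factor are those of the solution of the transport equation with this
source `S`; the proof only verifies the equation and the initial condition. -/
theorem momentSeries_one : momentSeries 1 = firstMomentFactor * baseSeries := by
  refine momentSeries_eq_mul_baseSeries one_ne_zero
    (S := (1 / 2 : ℚ) • (X * (twist^[2] (expMonomial 0 0 0)))) ?_ ?_ ?_
  -- Writing the factor `1` as a monomial lets `twist` be computed by `twist_expMonomial`.
  · have h : baseSeries = expMonomial 0 0 0 * baseSeries := by rw [expMonomial_zero, one_mul]
    simp only [sum_range_one, zero_add, Nat.sub_self, momentSeries_zero, powSumOp_one]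
    conv_lhs => rw [h]
    rw [iterate_derivative_mul_baseSeries]
    simp [mul_assoc]
  · simp only [firstMomentFactor, twist_add, twist_sub, twist_smul, twist_expMonomial,
      Function.iterate_succ, Function.iterate_zero, Function.comp_apply, id_eq,
      map_add, Derivation.map_smul, coeffDerivative_expMonomial]
    simp only [derivative_ratSmul, derivative_expMonomial, mul_add, mul_sub,
      mul_smul_comm, X_mul_expMonomial, one_add_X_mul_expMonomial, smul_add, smul_sub, smul_smul]
    norm_num only
    module
  · simp only [firstMomentFactor, map_add, map_smul, egfTerm_zero_expMonomial]
    norm_num only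
    simp only [if_true, if_false, smul_zero, pow_one]
    module

theorem momentSeries_two : momentSeries 2 = secondMomentFactor * baseSeries := by
  refine momentSeries_eq_mul_baseSeries two_ne_zero
    (S := X * (twist^[2] firstMomentFactor) + ((1 / 2 : ℚ) • (X * (twist^[2] (expMonomial 0 0 0))) +
      (1 / 3 : ℚ) • (X * (X * (twist^[3] (expMonomial 0 0 0)))))) ?_ ?_ ?_
  · have h : baseSeries = expMonomial 0 0 0 * baseSeries := by rw [expMonomial_zero, one_mul]
    simp only [sum_range_succ, range_zero, sum_empty, zero_add, Nat.reduceAdd, Nat.reduceSub,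
      momentSeries_zero, momentSeries_one, powSumOp_one, powSumOp_two]
    rw [iterate_derivative_mul_baseSeries]
    conv_lhs =>
      arg 2
      rw [h]
    rw [iterate_derivative_mul_baseSeries, iterate_derivative_mul_baseSeries]
    simp [smul_smul, add_mul, mul_assoc, pow_two]
  · simp only [firstMomentFactor, secondMomentFactor, twist_add, twist_sub, twist_smul,
      twist_expMonomial, Function.iterate_succ, Function.iterate_zero, Function.comp_apply, id_eq,
      map_add, Derivation.map_smul, coeffDerivative_expMonomial]
    simp only [derivative_ratSmul, derivative_expMonomial, mul_add, mul_sub,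
      mul_smul_comm, X_mul_expMonomial, one_add_X_mul_expMonomial, smul_add, smul_sub, smul_smul]
    norm_num only
    module
  · simp only [secondMomentFactor, map_add, map_smul, egfTerm_zero_expMonomial]
    norm_num only
    simp only [if_true, if_false, smul_zero, pow_one]
    module

theorem bell_natCast (n : ℕ) : bell (n : ℤ) = Nat.bell n := by
  simp [bell]

theorem bell_natCast_add (n i : ℕ) : bell ((n : ℤ) + (i : ℤ)) = Nat.bell (n + i) := by
  rw [← Nat.cast_add, bell_natCast]

theorem moment_one (n : ℕ) : moment 1 n =
    (1 / 4 : ℚ) *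
      ((2 * (n : ℚ) + 1) * bell (n : ℤ) + (2 * (n : ℚ) + 9) * bell ((n : ℤ) + 1)
        - 5 * bell ((n : ℤ) + 2)) := by
  have h0 := seqTerm_bellSeries
  have h1 := fun n => seqTerm_exp_pow_mul_bellSeries_succ n 0
  have h2 := fun n => seqTerm_exp_pow_mul_bellSeries_succ n 1
  have b1 : bell ((n : ℤ) + 1) = _ := bell_natCast_add n 1
  have b2 : bell ((n : ℤ) + 2) = _ := bell_natCast_add n 2
  simp only [zero_add, one_add_one_eq_two, pow_zero, one_mul] at h1 h2
  rw [← constantCoeff_momentSeries, momentSeries_one, firstMomentFactor, b1, b2, bell_natCast]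
  simp only [add_mul, smul_mul_assoc, map_add, map_rat_smul,
    constantCoeff_expMonomial_mul_baseSeries, seqTerm_X_pow_mul, h0, h1, h2, pow_zero, one_mul,
    Nat.descFactorial_one, smul_eq_mul]
  -- Multiplication by `z` produces terms of index `n - 1`; splitting off `n = 0` removes the
  -- truncated subtraction.
  rcases n with _ | n
  · push_cast
    ring
  · rw [Nat.add_sub_cancel]
    push_cast
    ring_nf

theorem moment_two (n : ℕ) : moment 2 n =
    (1 / 144 : ℚ) *
      ((36 * (n : ℚ) ^ 2 + 24 * (n : ℚ) - 23) * bell (n : ℤ)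
        + (72 * (n : ℚ) ^ 2 + 72 * (n : ℚ) - 260) * bell ((n : ℤ) + 1)
        + (36 * (n : ℚ) ^ 2 + 156 * (n : ℚ) + 489) * bell ((n : ℤ) + 2)
        - (180 * (n : ℚ) + 814) * bell ((n : ℤ) + 3)
        + 225 * bell ((n : ℤ) + 4)) := by
  have h0 := seqTerm_bellSeries
  have h1 := fun n => seqTerm_exp_pow_mul_bellSeries_succ n 0
  have h2 := fun n => seqTerm_exp_pow_mul_bellSeries_succ n 1
  have h3 := fun n => seqTerm_exp_pow_mul_bellSeries_succ n 2
  have h4 := fun n => seqTerm_exp_pow_mul_bellSeries_succ n 3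
  have b1 : bell ((n : ℤ) + 1) = _ := bell_natCast_add n 1
  have b2 : bell ((n : ℤ) + 2) = _ := bell_natCast_add n 2
  have b3 : bell ((n : ℤ) + 3) = _ := bell_natCast_add n 3
  have b4 : bell ((n : ℤ) + 4) = _ := bell_natCast_add n 4
  simp only [zero_add, one_add_one_eq_two, pow_zero, one_mul, Nat.reduceAdd] at h1 h2 h3 h4
  rw [← constantCoeff_momentSeries, momentSeries_two, secondMomentFactor, b1, b2, b3, b4,
    bell_natCast]
  simp only [add_mul, smul_mul_assoc, map_add, map_rat_smul,
    constantCoeff_expMonomial_mul_baseSeries, seqTerm_X_pow_mul, h0, h1, h2, h3, h4, pow_zero,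
    one_mul, cast_descFactorial_succ n 1, Nat.descFactorial_one, smul_eq_mul]
  rcases n with _ | _ | n
  · push_cast
    ring
  · push_cast
    ring_nf
  · rw [show n + 1 + 1 - 1 = n + 1 from rfl, show n + 1 + 1 - 2 = n from rfl]
    push_cast
    ring_nf

end ExplicitMoments

end SetPartition

theorem theorem3p4 :
    (∀ k : ℕ, ∃ Q : ℤ → Polynomial ℚ,
      (∀ j : ℕ, j ≤ 3 * k → (Q (2 * (k : ℤ) - (j : ℤ))).natDegree ≤ j) ∧
      ∀ n : ℕ, SetPartition.moment k n =
        ∑ m ∈ Finset.Icc (-(k : ℤ)) (2 * (k : ℤ)),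
          (Q m).eval (n : ℚ) * SetPartition.bell ((n : ℤ) + m)) ∧
    (∀ n : ℕ, SetPartition.moment 1 n =
      (1 / 4 : ℚ) *
        ((2 * (n : ℚ) + 1) * SetPartition.bell (n : ℤ)
          + (2 * (n : ℚ) + 9) * SetPartition.bell ((n : ℤ) + 1)
          - 5 * SetPartition.bell ((n : ℤ) + 2))) ∧
    (∀ n : ℕ, SetPartition.moment 2 n =
      (1 / 144 : ℚ) *
        ((36 * (n : ℚ) ^ 2 + 24 * (n : ℚ) - 23) * SetPartition.bell (n : ℤ)
          + (72 * (n : ℚ) ^ 2 + 72 * (n : ℚ) - 260) * SetPartition.bell ((n : ℤ) + 1)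
          + (36 * (n : ℚ) ^ 2 + 156 * (n : ℚ) + 489) * SetPartition.bell ((n : ℤ) + 2)
          - (180 * (n : ℚ) + 814) * SetPartition.bell ((n : ℤ) + 3)
          + 225 * SetPartition.bell ((n : ℤ) + 4))) := by
  exact ⟨SetPartition.isBellCombination_moment, SetPartition.moment_one, SetPartition.moment_two⟩
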